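/- Let $K$ be a number field with ring of integers $\overline{R}=\mathcal{O}_K$, and let $R\subseteq\overline{R}$ be an order in $K$ (a subring of $K$ that is finitely generated as a $\mathbb{Z}$-module and spans $K$ over $\mathbb{Q}$). Suppose that $R$ is an associated order, i.e. every $t\in\overline{R}$ can be written as $t=ru$ with $r\in R$ and $u$ a unit of $\overline{R}$, and that the conductor ideal $I=\{t\in\overline{R} : t\overline{R}\subseteq R\}$ is a radical ideal of $\overline{R}$. Then every irreducible element of the power series ring $R[[x]]$ is also irreducible in $\overline{R}[[x]]$. -/

import Mathlib

open scoped NumberField PowerSeries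

/-- A subring `R` of a number field `K` is an order in `K` if it is finitely generated as a
`ℤ`-module and spans `K` over `ℚ`. -/
structure IsOrder (K : Type*) [Field K] [NumberField K] (R : Subring K) : Prop where
  fg : R.toAddSubgroup.FG
  span_eq_top : Submodule.span ℚ (R : Set K) = ⊤

/-- Every order in `K` consists of algebraic integers. -/
theorem IsOrder.le_ringOfIntegers {K : Type*} [Field K] [NumberField K] {R : Subring K}
    (hR : IsOrder K R) : R ≤ (algebraMap (𝓞 K) K).range := by
  intro x hx
  have hint : IsIntegral ℤ x := by
    refine IsIntegral.of_mem_of_fg (subalgebraOfSubring R) ?_ x hx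
    have h := hR.fg
    rw [← AddSubgroup.toIntSubmodule_toAddSubgroup R.toAddSubgroup,
      ← Submodule.fg_iff_addSubgroup_fg] at h
    exact h
  exact ⟨⟨x, hint⟩, rfl⟩

/-- Every order in `K` is the image of a subring of the ring of integers `𝓞 K`, so nothing is lost
by taking the orders in `K` as subrings of `𝓞 K`. -/
theorem IsOrder.exists_map_eq {K : Type*} [Field K] [NumberField K] {R : Subring K}
    (hR : IsOrder K R) : ∃ S : Subring (𝓞 K), S.map (algebraMap (𝓞 K) K) = R :=
  ⟨R.comap (algebraMap (𝓞 K) K), by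
    rw [Subring.map_comap_eq]
    exact inf_eq_left.mpr hR.le_ringOfIntegers⟩

/-- A subring `R` of `T` is an associated subring if `T = R · U(T)`. -/
def IsAssociatedSubring {T : Type*} [CommRing T] (R : Subring T) : Prop :=
  ∀ t : T, ∃ r ∈ R, ∃ u : Tˣ, t = r * u

/-- The conductor ideal `(R : T) = {t ∈ T | t T ⊆ R}`, as an ideal of `T`. -/
def conductorIdeal {T : Type*} [CommRing T] (R : Subring T) : Ideal T where
  carrier := {t | ∀ s : T, t * s ∈ R}
  zero_mem' := fun s => by
    rw [zero_mul]
    exact R.zero_mem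
  add_mem' := fun {a b} ha hb s => by
    rw [add_mul]
    exact R.add_mem (ha s) (hb s)
  smul_mem' := fun c a ha s => by
    have h : c • a * s = a * (c * s) := by
      rw [smul_eq_mul]
      ring
    rw [h]
    exact ha (c * s)

/-! Write `T` for the ring of integers. The conductor is nonzero and radical, hence a finite
intersection of maximal ideals `P i`. Let `f = g * h` over `T` with `f` over `R`. Modulo `P i`, `g`
is zero or a unit times a power of `X`, so shifting a unit between the factors puts both over the
image of `R`. Associatedness makes it possible to glue these units into a single unit `W` of `T⟦X⟧`,
up to constants from `R`. It also keeps the contractions of the `P i` to `R` distinct, so the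
Chinese remainder theorem holds in `R` and membership in `R` can be tested modulo each `P i`. Thus
`f = (g * W) * (h * W⁻¹)` is a factorization over `R`, where `f` is irreducible. -/

namespace PowerSeries

/-- Over a field `K` with a subring `F`, every factorization of a power series with coefficients
in `F` becomes, after moving a unit from one factor to the other, a factorization over `F`. -/
theorem exists_unit_mul_coeff_mem {K : Type*} [Field K] (F : Subring K) (g h : K⟦X⟧)
    (hgh : ∀ n, coeff n (g * h) ∈ F) :
    ∃ U V : K⟦X⟧, U * V = 1 ∧ (∀ n, coeff n (g * U) ∈ F) ∧ ∀ n, coeff n (h * V) ∈ F := by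
  have hX : ∀ a n, coeff n (X ^ a : K⟦X⟧) ∈ F := fun a n => by
    rw [coeff_X_pow]
    split_ifs
    exacts [F.one_mem, F.zero_mem]
  have key : ∀ g h : K⟦X⟧, g ≠ 0 → (∀ n, coeff n (g * h) ∈ F) →
      ∃ U V : K⟦X⟧, U * V = 1 ∧ (∀ n, coeff n (g * U) ∈ F) ∧ ∀ n, coeff n (h * V) ∈ F := by
    intro g h hg hgh
    obtain ⟨a, w, rfl⟩ := IsDiscreteValuationRing.eq_unit_mul_pow_irreducible hg
      (X_prime (R := K)).irreducible
    refine ⟨(w⁻¹ : K⟦X⟧ˣ), w, w.inv_mul, fun n => ?_, fun n => ?_⟩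
    · rw [mul_right_comm, w.mul_inv, one_mul]
      exact hX a n
    · have := hgh (n + a)
      rwa [mul_right_comm, coeff_mul_X_pow, mul_comm] at this
  by_cases hg : g = 0
  · subst hg
    by_cases hh : h = 0
    · subst hh
      exact ⟨1, 1, one_mul 1, by simp [F.zero_mem], by simp [F.zero_mem]⟩
    · obtain ⟨U, V, hUV, h1, h2⟩ := key h 0 hh (by simp [F.zero_mem])
      exact ⟨V, U, by rw [mul_comm, hUV], h2, h1⟩
  · exact key g h hg hgh

theorem mem_range_map_subtype {T : Type*} [CommRing T] (R : Subring T) (p : T⟦X⟧)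
    (hp : ∀ n, coeff n p ∈ R) : ∃ q : R⟦X⟧, map R.subtype q = p :=
  ⟨mk fun n => ⟨coeff n p, hp n⟩, by ext n; simp⟩

end PowerSeries

section AssociatedSubring

variable {T : Type*} [CommRing T] {R : Subring T}

theorem mem_of_mem_conductorIdeal {t : T} (ht : t ∈ conductorIdeal R) : t ∈ R := by
  simpa using ht 1

/-- The contractions of distinct primes to an associated subring are incomparable. -/
theorem IsAssociatedSubring.le_of_comap_le (hassoc : IsAssociatedSubring R) {P Q : Ideal T}
    (h : P.comap R.subtype ≤ Q.comap R.subtype) : P ≤ Q := by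
  intro t ht
  obtain ⟨r, hr, u, rfl⟩ := hassoc t
  have hrP : r ∈ P := (Ideal.mul_unit_mem_iff_mem P u.isUnit).1 ht
  exact Q.mul_mem_right _ (h (x := ⟨r, hr⟩) hrP)

variable {ι : Type*} [Finite ι] {P : ι → Ideal T}

/-- The Chinese remainder theorem for the contractions of maximal ideals to an associated
subring. -/
theorem IsAssociatedSubring.exists_forall_sub_mem (hassoc : IsAssociatedSubring R)
    [Algebra.IsIntegral R T] (hP : ∀ i, (P i).IsMaximal) (hinj : Function.Injective P)
    (x : ι → R) : ∃ r : R, ∀ i, (r : T) - x i ∈ P i := by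
  have hmax : ∀ i, ((P i).comap R.subtype).IsMaximal := fun i =>
    have := hP i
    Ideal.isMaximal_comap_of_isIntegral_of_isMaximal (R := R) (P i)
  have hcop : Pairwise (Function.onFun IsCoprime fun i => (P i).comap R.subtype) := by
    intro i j hij
    have := hmax i
    have := hmax j
    refine Ideal.isCoprime_of_isMaximal fun h => hij (hinj ?_)
    exact le_antisymm (hassoc.le_of_comap_le h.le) (hassoc.le_of_comap_le h.ge)
  obtain ⟨r, hr⟩ := Ideal.exists_forall_sub_mem_ideal hcop x
  exact ⟨r, fun i => hr i⟩

/-- If the conductor is an intersection of maximal ideals, membership in an associated subring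
can be tested modulo each of them. -/
theorem IsAssociatedSubring.mem_of_forall_quotient_mem (hassoc : IsAssociatedSubring R)
    [Algebra.IsIntegral R T] (hP : ∀ i, (P i).IsMaximal) (hinj : Function.Injective P)
    (hinf : ⨅ i, P i ≤ conductorIdeal R) {t : T}
    (ht : ∀ i, Ideal.Quotient.mk (P i) t ∈ R.map (Ideal.Quotient.mk (P i))) : t ∈ R := by
  choose x hxR hx using ht
  obtain ⟨r, hr⟩ := hassoc.exists_forall_sub_mem hP hinj fun i => ⟨x i, hxR i⟩
  -- `r` agrees with `t` modulo every `P i`, so `t - r` lies in the conductor.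
  have hmem : t - r ∈ R := mem_of_mem_conductorIdeal <| hinf <| by
    rw [Ideal.mem_iInf]
    intro i
    have h1 := (Ideal.Quotient.mk_eq_mk_iff_sub_mem _ _).1 (hx i)
    have h2 := (P i).neg_mem ((P i).add_mem (hr i) h1)
    convert h2 using 1
    ring
  simpa using R.add_mem hmem r.2

open PowerSeries in
/-- Any family of units of the power series rings over the residue fields lifts, up to constants
coming from an associated subring, to a unit of the power series ring. -/
theorem IsAssociatedSubring.exists_unit_lift (hassoc : IsAssociatedSubring R)
    [Algebra.IsIntegral R T] (hP : ∀ i, (P i).IsMaximal) (hinj : Function.Injective P)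
    (U V : ∀ i, (T ⧸ P i)⟦X⟧) (hUV : ∀ i, U i * V i = 1) :
    ∃ W : T⟦X⟧ˣ, ∀ i, ∃ r s : R, (s * r : T) - 1 ∈ P i ∧
      map (Ideal.Quotient.mk (P i)) (W : T⟦X⟧) = C (Ideal.Quotient.mk (P i) (s : T)) * U i ∧
      map (Ideal.Quotient.mk (P i)) ((W⁻¹ : T⟦X⟧ˣ) : T⟦X⟧) =
        C (Ideal.Quotient.mk (P i) (r : T)) * V i := by
  have hcop : Pairwise (Function.onFun IsCoprime P) := fun i j hij =>
    have := hP i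
    have := hP j
    Ideal.isCoprime_of_isMaximal (hinj.ne hij)
  have crt : ∀ y : ∀ i, T ⧸ P i, ∃ t : T, ∀ i, Ideal.Quotient.mk (P i) t = y i := fun y => by
    obtain ⟨t, ht⟩ := Ideal.pi_quotient_surjective hcop y
    exact ⟨t, ht⟩
  obtain ⟨c, hc⟩ := crt fun i => constantCoeff (U i)
  -- `c` is a unit modulo each `P i` but perhaps not in `T`. Its unit part `u` serves as constant
  -- term of `W`; the discrepancy `r` is inverted modulo `P i` by some `s` in `R`.
  obtain ⟨r, hr, u, rfl⟩ := hassoc c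
  have hs : ∀ i, ∃ s : R, (s * r : T) - 1 ∈ P i := by
    intro i
    have := hP i
    have hmax : ((P i).comap R.subtype).IsMaximal :=
      Ideal.isMaximal_comap_of_isIntegral_of_isMaximal (R := R) (P i)
    have hrP : (⟨r, hr⟩ : R) ∉ (P i).comap R.subtype := by
      intro hrP
      have h0 : Ideal.Quotient.mk (P i) (r * u) = 0 :=
        Ideal.Quotient.eq_zero_iff_mem.2 ((P i).mul_mem_right _ hrP)
      have h1 := congrArg constantCoeff (hUV i)
      rw [map_mul, ← hc i, h0, zero_mul, map_one] at h1
      exact zero_ne_one h1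
    obtain ⟨s, y, hy, hsy⟩ := hmax.exists_inv hrP
    refine ⟨s, ?_⟩
    have hyP : (y : T) ∈ P i := hy
    have hsy' : (s * r : T) + y = 1 := congrArg R.subtype hsy
    rw [show (s * r : T) - 1 = -y by rw [← hsy']; ring]
    exact (P i).neg_mem hyP
  choose s hs using hs
  have hs' : ∀ i, Ideal.Quotient.mk (P i) (s i : T) * Ideal.Quotient.mk (P i) r = 1 := fun i => by
    rw [← map_mul, ← map_one (Ideal.Quotient.mk (P i))]
    exact (Ideal.Quotient.mk_eq_mk_iff_sub_mem _ _).2 (hs i)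
  choose d hd using fun n => crt fun i => Ideal.Quotient.mk (P i) (s i : T) * coeff n (U i)
  let w : T⟦X⟧ := mk fun n => if n = 0 then (u : T) else d n
  have hw : IsUnit w := by
    rw [isUnit_iff_constantCoeff, ← coeff_zero_eq_constantCoeff_apply]
    simp [w]
  obtain ⟨W, hW⟩ := hw
  have hWU : ∀ i, map (Ideal.Quotient.mk (P i)) (W : T⟦X⟧) =
      C (Ideal.Quotient.mk (P i) (s i : T)) * U i := by
    intro i
    ext n
    rw [hW, coeff_map, coeff_C_mul, coeff_mk]
    split_ifs with hn
    · subst hn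
      rw [coeff_zero_eq_constantCoeff_apply, ← hc i, map_mul, ← mul_assoc, hs' i, one_mul]
    · exact hd n i
  refine ⟨W, fun i => ⟨⟨r, hr⟩, s i, hs i, hWU i, ?_⟩⟩
  have h1 : map (Ideal.Quotient.mk (P i)) ((W⁻¹ : T⟦X⟧ˣ) : T⟦X⟧) *
      map (Ideal.Quotient.mk (P i)) (W : T⟦X⟧) = 1 := by
    rw [← map_mul, W.inv_mul, map_one]
  have h2 : C (Ideal.Quotient.mk (P i) (s i : T)) * C (Ideal.Quotient.mk (P i) r) =
      (1 : (T ⧸ P i)⟦X⟧) := by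
    rw [← map_mul, hs' i, map_one]
  rw [hWU i] at h1
  refine left_inv_eq_right_inv h1 ?_
  rw [mul_mul_mul_comm, h2, hUV i, one_mul]

open PowerSeries in
-- The constants by which the lifted unit differs from the residue field units come from `R`, so
-- they do not affect membership in its image.
theorem IsAssociatedSubring.exists_unit_mul_coeff_mem (hassoc : IsAssociatedSubring R)
    [Algebra.IsIntegral R T] (hP : ∀ i, (P i).IsMaximal) (hinj : Function.Injective P)
    (hinf : ⨅ i, P i ≤ conductorIdeal R) (g h : T⟦X⟧) (hgh : ∀ n, coeff n (g * h) ∈ R) :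
    ∃ W : T⟦X⟧ˣ, (∀ n, coeff n (g * (W : T⟦X⟧)) ∈ R) ∧
      ∀ n, coeff n (h * ((W⁻¹ : T⟦X⟧ˣ) : T⟦X⟧)) ∈ R := by
  have hfield : ∀ i, ∃ U V : (T ⧸ P i)⟦X⟧, U * V = 1 ∧
      (∀ n, coeff n (map (Ideal.Quotient.mk (P i)) g * U) ∈ R.map (Ideal.Quotient.mk (P i))) ∧
      ∀ n, coeff n (map (Ideal.Quotient.mk (P i)) h * V) ∈ R.map (Ideal.Quotient.mk (P i)) := by
    intro i
    have := hP i
    let _ := Ideal.Quotient.field (P i)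
    refine PowerSeries.exists_unit_mul_coeff_mem (R.map (Ideal.Quotient.mk (P i))) _ _ fun n => ?_
    rw [← map_mul, coeff_map]
    exact ⟨_, hgh n, rfl⟩
  choose U V hUV hU hV using hfield
  obtain ⟨W, hW⟩ := hassoc.exists_unit_lift hP hinj U V hUV
  refine ⟨W, fun n => hassoc.mem_of_forall_quotient_mem hP hinj hinf fun i => ?_,
    fun n => hassoc.mem_of_forall_quotient_mem hP hinj hinf fun i => ?_⟩
  · obtain ⟨r, s, -, h1, -⟩ := hW i
    rw [← coeff_map, map_mul, h1, mul_left_comm, coeff_C_mul]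
    exact Subring.mul_mem _ ⟨s, s.2, rfl⟩ (hU i n)
  · obtain ⟨r, s, -, -, h1⟩ := hW i
    rw [← coeff_map, map_mul, h1, mul_left_comm, coeff_C_mul]
    exact Subring.mul_mem _ ⟨r, r.2, rfl⟩ (hV i n)

open PowerSeries in
/-- An associated subring whose conductor contains a finite intersection of maximal ideals is
such that irreducible power series over it remain irreducible over the whole ring. -/
theorem IsAssociatedSubring.irreducible_map (hassoc : IsAssociatedSubring R)
    [Algebra.IsIntegral R T] (hP : ∀ i, (P i).IsMaximal) (hinj : Function.Injective P)
    (hinf : ⨅ i, P i ≤ conductorIdeal R) {f : R⟦X⟧} (hf : Irreducible f) :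
    Irreducible (map R.subtype f : T⟦X⟧) := by
  have hinjR : Function.Injective (map R.subtype : R⟦X⟧ → T⟦X⟧) :=
    map_injective _ R.subtype_injective
  refine ⟨fun hu => hf.not_isUnit ?_, fun g h hgh => ?_⟩
  · rw [isUnit_iff_constantCoeff] at hu ⊢
    rw [← coeff_zero_eq_constantCoeff_apply, coeff_map, coeff_zero_eq_constantCoeff_apply] at hu
    -- By integrality, an element of `R` invertible in `T` is invertible in `R`.
    exact isUnit_of_map_unit (algebraMap R T) _ hu
  · obtain ⟨W, hg, hh⟩ := hassoc.exists_unit_mul_coeff_mem hP hinj hinf g h fun n => by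
      rw [← hgh, coeff_map]
      exact (coeff n f).2
    obtain ⟨g', hg'⟩ := mem_range_map_subtype R _ hg
    obtain ⟨h', hh'⟩ := mem_range_map_subtype R _ hh
    have hfac : f = g' * h' := hinjR <| by
      rw [map_mul, hg', hh', mul_mul_mul_comm, W.mul_inv, mul_one, hgh]
    refine (hf.isUnit_or_isUnit hfac).imp (fun hu => ?_) (fun hu => ?_)
    · have := hu.map (map R.subtype)
      rwa [hg', Units.isUnit_mul_units] at this
    · have := hu.map (map R.subtype)
      rwa [hh', Units.isUnit_mul_units] at this

end AssociatedSubring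

section Order

variable {K : Type*} [Field K] [NumberField K] {R : Subring (𝓞 K)}

theorem IsOrder.exists_nsmul_mem {S : Subring K} (hS : IsOrder K S) (x : K) :
    ∃ n : ℕ, n ≠ 0 ∧ n • x ∈ S := by
  have hx : x ∈ Submodule.span ℚ (S : Set K) := hS.span_eq_top ▸ Submodule.mem_top
  induction hx using Submodule.span_induction with
  | mem x hx => exact ⟨1, one_ne_zero, by simpa using hx⟩
  | zero => exact ⟨1, one_ne_zero, by simp⟩
  | add x y _ _ hx hy =>
    obtain ⟨m, hm, hmx⟩ := hx
    obtain ⟨n, hn, hny⟩ := hy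
    refine ⟨m * n, mul_ne_zero hm hn, ?_⟩
    rw [smul_add, mul_smul, mul_smul, smul_comm m n x]
    exact S.add_mem (nsmul_mem hmx n) (nsmul_mem hny m)
  | smul q x _ hx =>
    obtain ⟨m, hm, hmx⟩ := hx
    refine ⟨q.den * m, mul_ne_zero q.den_nz hm, ?_⟩
    have h : (q.den * m) • q • x = q.num • m • x := by
      have hq : (q.den : K) * (q : K) = q.num := by exact_mod_cast Rat.den_mul_eq_num q
      simp only [nsmul_eq_mul, zsmul_eq_mul, Rat.smul_def, Nat.cast_mul, ← hq]
      ring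
    rw [h]
    exact zsmul_mem hmx _

/-- The quotient `𝓞 K ⧸ R` is a finitely generated torsion group, so a single nonzero integer kills
it and hence lies in the conductor. -/
theorem conductorIdeal_ne_bot_of_isOrder (hR : IsOrder K (R.map (algebraMap (𝓞 K) K))) :
    conductorIdeal R ≠ ⊥ := by
  let M : Submodule ℤ (𝓞 K) := AddSubgroup.toIntSubmodule R.toAddSubgroup
  have htor : Module.IsTorsion ℤ (𝓞 K ⧸ M) := by
    intro y
    obtain ⟨b, rfl⟩ := M.mkQ_surjective y
    obtain ⟨n, hn, r, hr, hrb⟩ := hR.exists_nsmul_mem (algebraMap (𝓞 K) K b)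
    have hrn : r = n • b := by
      apply FaithfulSMul.algebraMap_injective (𝓞 K) K
      rw [map_nsmul]
      exact hrb
    refine ⟨⟨n, mem_nonZeroDivisors_of_ne_zero (by exact_mod_cast hn)⟩, ?_⟩
    change (n : ℤ) • M.mkQ b = 0
    rw [← map_smul, Submodule.mkQ_apply, Submodule.Quotient.mk_eq_zero]
    change (n : ℤ) • b ∈ R
    rw [natCast_zsmul, ← hrn]
    exact hr
  obtain ⟨n, hn, hn0⟩ := Submodule.annihilator_top_inter_nonZeroDivisors htor
  refine (Submodule.ne_bot_iff _).2 ⟨(n : 𝓞 K), fun s => ?_, ?_⟩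
  · have h := Submodule.mem_annihilator.1 hn (M.mkQ s) Submodule.mem_top
    rw [← map_smul, Submodule.mkQ_apply, Submodule.Quotient.mk_eq_zero] at h
    have h' : n • s ∈ R := h
    rwa [zsmul_eq_mul] at h'
  · exact_mod_cast nonZeroDivisors.ne_zero hn0

end Order

theorem mainTheorem10 (K : Type*) [Field K] [NumberField K]
    (R : Subring (𝓞 K)) (hR : IsOrder K (R.map (algebraMap (𝓞 K) K)))
    (hassoc : IsAssociatedSubring R) (hrad : (conductorIdeal R).IsRadical)
    (f : R⟦X⟧) (hf : Irreducible f) :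
    Irreducible (PowerSeries.map R.subtype f : (𝓞 K)⟦X⟧) := by
  have hint : Algebra.IsIntegral R (𝓞 K) := Algebra.IsIntegral.tower_top ℤ
  have hne := conductorIdeal_ne_bot_of_isOrder hR
  have : Finite (conductorIdeal R).minimalPrimes :=
    (Ideal.finite_minimalPrimes_of_isNoetherianRing (𝓞 K) (conductorIdeal R)).to_subtype
  refine hassoc.irreducible_map (P := fun p : (conductorIdeal R).minimalPrimes => (p : Ideal (𝓞 K)))
    (fun p => ?_) Subtype.val_injective ?_ hf
  · have hp := p.2.1
    -- Nonzero primes of a Dedekind domain are maximal, and these contain the nonzero conductor.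
    exact hp.1.isMaximal fun h => hne (le_bot_iff.1 (h ▸ hp.2))
  · rw [← sInf_eq_iInf', Ideal.sInf_minimalPrimes, hrad.radical]
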